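/- **Setting.** Fix $n\ge 0$ and $c_\ell\in\mathbb R$; $i,j$ run over $0,\dots,n$, $a,b,c$ over $1,\dots,n$, and repeated indices are summed. The Heisenberg group $\mathrm{Heis}_{2n+3}(\mathbb R)\cong\mathbb R^{2n+3}$, with coordinates $(\eta^i,\tilde\eta_i,\kappa)$, acts on $\mathbb R\times\mathbb C^n\times\mathbb R^{2n+2}\times\mathbb R\ni(\rho,z^a,\zeta^i,\tilde\zeta_i,\sigma)$ by $$(\eta^i,\tilde\eta_i,\kappa)\cdot(\rho,z^a,\zeta^i,\tilde\zeta_i,\sigma)=(\rho,\,z^a,\,\zeta^i+\eta^i,\,\tilde\zeta_i+\tilde\eta_i,\,\sigma+\kappa+\tilde\zeta_i\eta^i-\zeta^i\tilde\eta_i).$$ Put $\mathrm{Heis}_{2n+3,D}=\{\eta^i\in\mathbb Z\text{ for all }i\}$ and $H_{2n+2}=\{\eta^0=0\}$. *Instanton corrected c-map spaces.* Let $(M,\mathfrak F)$ be a CASK domain: $M\subset\mathbb C^{n+1}$ is open and $\mathbb C^\times$-invariant, $Z^0\neq0$ on $M$, $\mathfrak F$ is holomorphic and homogeneous of degree $2$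 on $M$, and, with $\tau_{ij}=\partial_i\partial_j\mathfrak F$, the matrix $\mathrm{Im}(\tau_{ij})$ has signature $(n,1)$ and $\mathrm{Im}(\tau_{ij})Z^i\bar Z^j<0$. Put $\mathfrak F_i=\partial_i\mathfrak F$, $g_M=-\mathrm{Im}(\tau_{ij})dZ^id\bar Z^j$, $r^2=-\mathrm{Im}(\tau_{ij})Z^i\bar Z^j$. Let $\Omega:\mathbb Z^{n+1}\to\mathbb Z$ with $\Omega(0)=0$, $\Omega(-q)=\Omega(q)$; for $\gamma=q\in\mathbb Z^{n+1}$ put $Z_\gamma=q_iZ^i$ and $\zeta_\gamma=-q_i\zeta^i$. Assume that $\Omega$ defines a (mutually local) variation of BPS structures on $M$: on each compact subset of $M$ there is $C>0$ with $|Z_\gamma|>C|\gamma|$ whenever $\Omega(\gamma)\neq0$, and $\sum_\gamma\Omega(\gamma)e^{-R|Z_\gamma|}$ converges normally on compact subsets of $M$ for all $R>0$. With the modified Bessel functions $K_0,K_1$ put $$V_\gamma=\frac1{2\pi}\sum_{m>0}e^{2\pi\mathrm i m\zeta_\gamma}K_0(2\pi m|Z_\gamma|),\qquad A_\gamma=-\frac1{4\pi}\sum_{m>0}e^{2\pi\mathrm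 i m\zeta_\gamma}|Z_\gamma|K_1(2\pi m|Z_\gamma|)\Big(\frac{dZ_\gamma}{Z_\gamma}-\frac{d\bar Z_\gamma}{\bar Z_\gamma}\Big),$$ $$\eta_\gamma=\frac{\mathrm i}{8\pi^2}\sum_{m>0}\frac{e^{2\pi\mathrm i m\zeta_\gamma}}m|Z_\gamma|K_1(2\pi m|Z_\gamma|)\Big(\frac{dZ_\gamma}{Z_\gamma}-\frac{d\bar Z_\gamma}{\bar Z_\gamma}\Big).$$ Let $M_0$ be the maximal open subset of $M$ such that the restriction of $\Omega$ to $M_0$ is a variation of BPS structures and $g_M-\sum_\gamma\Omega(\gamma)V_\gamma|dZ_\gamma|^2$ is non-degenerate in the directions of $M_0$ at all points of $M_0\times\mathbb R^{2n+2}\ni(Z^i,\zeta^i,\tilde\zeta_i)$. On $M_0\times\mathbb R^{2n+2}$ let $g_N$ be the pseudo-hyperkähler metric with Kähler forms $$\omega_1+\mathrm i\omega_2=-2\pi\Big(d\mathfrak F_i\wedge d\zeta^i-dZ^i\wedge d\tilde\zeta_i+\sum_\gamma\Omega(\gamma)\big(dZ_\gamma\wedge A_\gamma+\mathrm iV_\gamma\,d\zeta_\gamma\wedge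 dZ_\gamma\big)\Big),$$ $$\omega_3=2\pi\Big(-\tfrac{\mathrm i}2\mathrm{Im}(\tau_{ij})dZ^i\wedge d\bar Z^j+d\tilde\zeta_i\wedge d\zeta^i-\sum_\gamma\Omega(\gamma)\big(\tfrac{\mathrm i}2V_\gamma\,dZ_\gamma\wedge d\bar Z_\gamma+d\zeta_\gamma\wedge A_\gamma\big)\Big),$$ that is, $\omega_k=g_N(I_k\cdot,\cdot)$ with $I_1I_2=I_3$. Let $V=2\mathrm iZ^i\partial_{Z^i}-2\mathrm i\bar Z^i\partial_{\bar Z^i}$, $f=2\pi\big(r^2-8c_\ell-\sum_\gamma\Omega(\gamma)\iota_V\eta_\gamma\big)$, $f_3=f-\tfrac12g_N(V,V)$, and on $M_0\times\mathbb R^{2n+2}\times\mathbb R\ni(Z^i,\zeta^i,\tilde\zeta_i,\sigma)$ put $$\eta=\pi(d\sigma+\tilde\zeta_id\zeta^i-\zeta^id\tilde\zeta_i)+\tfrac{\pi\mathrm i}2(\bar\partial r^2-\partial r^2)-2\pi\sum_\gamma\Omega(\gamma)\eta_\gamma-\tfrac12\iota_Vg_N,$$ $\theta_0=-\tfrac12df$,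 $\theta_1=\tfrac12\iota_V\omega_2$, $\theta_2=-\tfrac12\iota_V\omega_1$, $\theta_3=\eta+\tfrac12\iota_Vg_N$. The instanton corrected c-map space $(\widetilde N,g_{\overline N})$ with 1-loop parameter $c_\ell$ is the hypersurface $\{Z^0>0\}$ in the open set $\{f\ne0,\ f_3\neq0,\ g_N(V,V)\neq0\}$ of $M_0\times\mathbb R^{2n+2}\times\mathbb R$, with $$g_{\overline N}=-\frac1f\Big(\frac2{f_3}\eta^2+g_N-\frac2f\sum_{k=0}^3\theta_k^2\Big)\Big|_{\widetilde N},$$ regarded as a subset of $\{\rho>-c_\ell\}\subset\mathbb R\times\mathbb C^n\times\mathbb R^{2n+2}\times\mathbb R$ through the coordinates $(\rho,z^a,\zeta^i,\tilde\zeta_i,\sigma)$ with $16\pi\rho=2\pi r^2-16\pi c_\ell$ and $z^a=Z^a/Z^0$. *Instanton corrected q-map spaces.* Let $k_{abc}\in\mathbb R$ be symmetric, $h(t)=\frac16k_{abc}t^at^bt^c$, and let $\mathcal H\subset\{h=1\}\subset\mathbb R^n$ be a hypersurface on which $-\partial^2h$ is positive definite (a projective special real manifold). Let $\chi\in\mathbb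 Z$, $\Lambda^+=\mathbb Z_{\ge0}^n\setminus\{0\}$, and $n_{\hat\gamma}\in\mathbb Z$ for $\hat\gamma=(q_a)\in\Lambda^+$. With $t^a=\mathrm{Im}(Z^a/Z^0)$ put $$M^q=\{Z\in\mathbb C^{n+1}\mid Z^0\neq0,\ t\in\mathbb R_{>0}\mathcal H,\ q_at^a>0\text{ whenever }n_{\hat\gamma}\neq0\},$$ and assume that $M^q$ is open and that $\sum_{\hat\gamma}|n_{\hat\gamma}|e^{-\epsilon q_at^a}$ converges normally on compact subsets of $M^q$ for all $\epsilon>0$. The associated q-map space is the space $(\widetilde N,g_{\overline N})$ obtained by the construction above from $$\mathfrak F=-\frac16k_{abc}\frac{Z^aZ^bZ^c}{Z^0}+\chi\frac{(Z^0)^2\zeta(3)}{2(2\pi\mathrm i)^3}-\frac{(Z^0)^2}{(2\pi\mathrm i)^3}\sum_{\hat\gamma\in\Lambda^+}n_{\hat\gamma}\mathrm{Li}_3(e^{2\pi\mathrm iq_aZ^a/Z^0}),$$ with $M$ the maximal open subset of $M^q$ where $\mathrm{Im}(\tau_{ij})$ has signature $(n,1)$ and $\mathrm{Im}(\tau_{ij})Z^i\bar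 Z^j<0$, and from $\Omega(q_0,0)=-\chi$ for $q_0\ne0$, $\Omega(q_0,\pm\hat\gamma)=n_{\hat\gamma}$ for $q_0\in\mathbb Z$, $\hat\gamma\in\Lambda^+$, and $\Omega=0$ otherwise. **Proposition.** The action above restricts to an action of $\mathrm{Heis}_{2n+3,D}$ by isometries on any instanton corrected c-map space $(\widetilde N,g_{\overline N})$, in particular on any instanton corrected q-map space. If $(\widetilde N,g_{\overline N})$ is an instanton corrected q-map space with $n_{\hat\gamma}=0$ for all $\hat\gamma\in\Lambda^+$ (and $\chi$ arbitrary), it restricts to an action by isometries of $\{(\eta^i,\tilde\eta_i,\kappa)\in\mathrm{Heis}_{2n+3}(\mathbb R)\mid\eta^0\in\mathbb Z\}$, and in particular of $H_{2n+2}$. The same holds with $\widetilde N$ replaced by $\widetilde N\cap\{\rho>0\}$. -/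

import Mathlib

open scoped ContDiff

noncomputable section

/-! ### The Heisenberg group and its action on the coordinate space -/

/-- The Heisenberg group `Heis_{2n+3}(ℝ)` with its global coordinates `(η^i, η̃_i, κ)`, `i = 0, …, n`. -/
@[ext]
structure Heis (n : ℕ) where
  η : Fin (n + 1) → ℝ
  ηt : Fin (n + 1) → ℝ
  κ : ℝ

namespace Heis

variable {n : ℕ}

instance : Mul (Heis n) :=
  ⟨fun g h => ⟨g.η + h.η, g.ηt + h.ηt, g.κ + h.κ + ∑ i, (h.ηt i * g.η i - h.η i * g.ηt i)⟩⟩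

instance : One (Heis n) := ⟨⟨0, 0, 0⟩⟩

instance : Inv (Heis n) := ⟨fun g => ⟨-g.η, -g.ηt, -g.κ⟩⟩

@[simp] theorem mul_η (g h : Heis n) : (g * h).η = g.η + h.η := rfl
@[simp] theorem mul_ηt (g h : Heis n) : (g * h).ηt = g.ηt + h.ηt := rfl
@[simp] theorem mul_κ (g h : Heis n) :
    (g * h).κ = g.κ + h.κ + ∑ i, (h.ηt i * g.η i - h.η i * g.ηt i) := rfl
@[simp] theorem one_η : (1 : Heis n).η = 0 := rfl
@[simp] theorem one_ηt : (1 : Heis n).ηt = 0 := rfl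
@[simp] theorem one_κ : (1 : Heis n).κ = 0 := rfl
@[simp] theorem inv_η (g : Heis n) : g⁻¹.η = -g.η := rfl
@[simp] theorem inv_ηt (g : Heis n) : g⁻¹.ηt = -g.ηt := rfl
@[simp] theorem inv_κ (g : Heis n) : g⁻¹.κ = -g.κ := rfl

instance : Group (Heis n) :=
  Group.ofLeftAxioms
    (by
      intro a b c
      ext i
      · simp [add_assoc]
      · simp [add_assoc]
      · simp only [mul_κ, mul_η, mul_ηt, Pi.add_apply, add_mul, mul_add, Finset.sum_add_distrib,
          Finset.sum_sub_distrib]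
        ring)
    (by intro a; ext i <;> simp)
    (by
      intro a
      ext i
      · simp
      · simp
      · simp [mul_comm])

/-- `Heis_{2n+3,D}`: all `η^i` are integers. -/
def discrete (n : ℕ) : Subgroup (Heis n) where
  carrier := {g | ∀ i, ∃ m : ℤ, g.η i = m}
  mul_mem' := by
    intro a b ha hb i
    obtain ⟨m, hm⟩ := ha i
    obtain ⟨l, hl⟩ := hb i
    exact ⟨m + l, by simp [hm, hl]⟩
  one_mem' := fun i => ⟨0, by simp⟩
  inv_mem' := by
    intro a ha i
    obtain ⟨m, hm⟩ := ha i
    exact ⟨-m, by simp [hm]⟩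

/-- The subgroup `{η^0 ∈ ℤ}`. -/
def integralZero (n : ℕ) : Subgroup (Heis n) where
  carrier := {g | ∃ m : ℤ, g.η 0 = m}
  mul_mem' := by
    rintro a b ⟨m, hm⟩ ⟨l, hl⟩
    exact ⟨m + l, by simp [hm, hl]⟩
  one_mem' := ⟨0, by simp⟩
  inv_mem' := by
    rintro a ⟨m, hm⟩
    exact ⟨-m, by simp [hm]⟩

/-- The codimension one subgroup `H_{2n+2} = {η^0 = 0}`. -/
def codimOne (n : ℕ) : Subgroup (Heis n) where
  carrier := {g | g.η 0 = 0}
  mul_mem' := by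
    intro a b (ha : a.η 0 = 0) (hb : b.η 0 = 0)
    show (a * b).η 0 = 0
    simp [ha, hb]
  one_mem' := by simp
  inv_mem' := by
    intro a (ha : a.η 0 = 0)
    show (a⁻¹).η 0 = 0
    simp [ha]

end Heis

/-- The coordinate space of `(ρ, z^a, ζ^i, ζ̃_i, σ)`. -/
abbrev QKSpace (n : ℕ) : Type :=
  ℝ × (Fin n → ℂ) × (Fin (n + 1) → ℝ) × (Fin (n + 1) → ℝ) × ℝ

/-- `(η, η̃, κ) · (ρ, z, ζ, ζ̃, σ) = (ρ, z, ζ + η, ζ̃ + η̃, σ + κ + ζ̃_i η^i - ζ^i η̃_i)`. -/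
def Heis.act {n : ℕ} (h : Heis n) (p : QKSpace n) : QKSpace n :=
  (p.1, p.2.1, p.2.2.1 + h.η, p.2.2.2.1 + h.ηt,
    p.2.2.2.2 + h.κ + ∑ i, (p.2.2.2.1 i * h.η i - p.2.2.1 i * h.ηt i))

instance Heis.instMulAction (n : ℕ) : MulAction (Heis n) (QKSpace n) where
  smul := Heis.act
  one_smul p := by
    show Heis.act 1 p = p
    simp [Heis.act]
  mul_smul g h p := by
    show Heis.act (g * h) p = Heis.act g (Heis.act h p)
    simp only [Heis.act, Heis.mul_η, Heis.mul_ηt, Heis.mul_κ, Prod.mk.injEq, true_and]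
    refine ⟨by abel, by abel, ?_⟩
    simp only [Pi.add_apply, add_mul, mul_add, Finset.sum_add_distrib, Finset.sum_sub_distrib]
    ring

/-- The subgroup `H` acts (through the Heisenberg action above) by isometries on the subset `N` of
the coordinate space with the field `g` of bilinear forms: every element maps `N` onto `N`
diffeomorphically and its differential preserves `g`. -/
def ActsByIsometries {n : ℕ} (H : Subgroup (Heis n)) (N : Set (QKSpace n))
    (g : QKSpace n → QKSpace n → QKSpace n → ℝ) : Prop :=
  ∀ h ∈ H, (fun p : QKSpace n => h • p) '' N = N ∧
    ContDiff ℝ ∞ (fun p : QKSpace n => h • p) ∧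
    ∀ p ∈ N, ∀ X Y : QKSpace n,
      g (h • p) (fderiv ℝ (fun x : QKSpace n => h • x) p X)
        (fderiv ℝ (fun x : QKSpace n => h • x) p Y) = g p X Y

/-! ### Conical affine special Kähler domains -/

section CASK

variable {n : ℕ}

/-- `Z_i = ∂F/∂Z^i`. -/
def dPrepot (F : (Fin (n + 1) → ℂ) → ℂ) (i : Fin (n + 1)) (Z : Fin (n + 1) → ℂ) : ℂ :=
  fderiv ℂ F Z (Pi.single i 1)

/-- `τ_ij = ∂²F/∂Z^i∂Z^j`. -/
def tauMat (F : (Fin (n + 1) → ℂ) → ℂ) (Z : Fin (n + 1) → ℂ) :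
    Matrix (Fin (n + 1)) (Fin (n + 1)) ℂ :=
  fun i j => fderiv ℂ (dPrepot F i) Z (Pi.single j 1)

/-- `Im τ_ij`. -/
def imTau (F : (Fin (n + 1) → ℂ) → ℂ) (Z : Fin (n + 1) → ℂ) :
    Matrix (Fin (n + 1)) (Fin (n + 1)) ℝ :=
  fun i j => (tauMat F Z i j).im

/-- The real number `Im(τ_ij) X^i conj(X^j)`, where `τ` is evaluated at `Z`. -/
def imTauNorm (F : (Fin (n + 1) → ℂ) → ℂ) (Z X : Fin (n + 1) → ℂ) : ℝ :=
  ∑ i, ∑ j, imTau F Z i j * (X i * (starRingEnd ℂ) (X j)).re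

/-- A real symmetric matrix of size `n + 1` has signature `(n, 1)`. -/
def HasSignatureN1 (A : Matrix (Fin (n + 1)) (Fin (n + 1)) ℝ) : Prop :=
  ∃ P : Matrix (Fin (n + 1)) (Fin (n + 1)) ℝ, IsUnit P.det ∧
    P.transpose * A * P = Matrix.diagonal (Fin.cons (-1) (fun _ => 1))

/-- The two pointwise conditions on the prepotential of a CASK domain. -/
def CASKCondition (F : (Fin (n + 1) → ℂ) → ℂ) (Z : Fin (n + 1) → ℂ) : Prop :=
  HasSignatureN1 (imTau F Z) ∧ imTauNorm F Z Z < 0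

/-- A CASK domain `(M, F)`. Connectedness of `M` is not imposed. -/
structure IsCASKDomain (M : Set (Fin (n + 1) → ℂ)) (F : (Fin (n + 1) → ℂ) → ℂ) : Prop where
  isOpen : IsOpen M
  zero_coord_ne : ∀ Z ∈ M, Z 0 ≠ 0
  smul_mem : ∀ l : ℂ, l ≠ 0 → ∀ Z ∈ M, l • Z ∈ M
  holomorphic : DifferentiableOn ℂ F M
  homogeneous : ∀ l : ℂ, l ≠ 0 → ∀ Z ∈ M, F (l • Z) = l ^ 2 * F Z
  condition : ∀ Z ∈ M, CASKCondition F Z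

end CASK

/-! ### The hyperkähler side

The torus fibration `N = T*M/Γ*` is lifted to `M × ℝ^{2n+2}`, with coordinates `(Z^i, ζ^i, ζ̃_i)`
where `ζ^i = -ζ_{γ^i}` and `ζ̃_i = ζ_{γ̃_i}`; the circle bundle `P → N` is lifted to
`M × ℝ^{2n+2} × ℝ` with additional coordinate `σ`. A charge `γ = q_i γ^i` is encoded by the integer
vector `q`; the BPS indices `Ω` vanish off the span of the `γ^i`, so they are a function of `q`. -/

/-- The coordinate space of `(Z^i, ζ^i, ζ̃_i)`. -/
abbrev HKSpace (n : ℕ) : Type := (Fin (n + 1) → ℂ) × (Fin (n + 1) → ℝ) × (Fin (n + 1) → ℝ)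

/-- The coordinate space of `((Z^i, ζ^i, ζ̃_i), σ)`. -/
abbrev PSpace (n : ℕ) : Type := HKSpace n × ℝ

/-- Complex valued 1-forms at a point. -/
abbrev Form1 (n : ℕ) : Type := HKSpace n →L[ℝ] ℂ

/-- Complex valued bilinear forms at a point. -/
abbrev Form2 (n : ℕ) : Type := HKSpace n →L[ℝ] HKSpace n →L[ℝ] ℂ

/-- The modified Bessel function of the second kind `K_ν(x)`, for `x > 0`. -/
def besselK (ν x : ℝ) : ℝ :=
  ∫ t in Set.Ioi (0 : ℝ), Real.exp (-x * Real.cosh t) * Real.cosh (ν * t)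

section HK

variable {n : ℕ}

/-- `(X, Y) ↦ α(X) β(Y)`. -/
def tensor (α β : Form1 n) : Form2 n := (ContinuousLinearMap.mul ℝ ℂ).bilinearComp α β

/-- `(X, Y) ↦ α(X) β(Y) - α(Y) β(X)`. -/
def wedge (α β : Form1 n) : Form2 n := tensor α β - (tensor α β).flip

/-- The complex conjugate of a 1-form. -/
def conjForm (α : Form1 n) : Form1 n := (Complex.conjCLE : ℂ →L[ℝ] ℂ).comp α

/-- The real part of a bilinear form. -/
def reForm (B : Form2 n) : HKSpace n →L[ℝ] HKSpace n →L[ℝ] ℝ :=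
  (ContinuousLinearMap.compL ℝ (HKSpace n) ℂ ℝ Complex.reCLM).comp B

/-- The imaginary part of a bilinear form. -/
def imForm (B : Form2 n) : HKSpace n →L[ℝ] HKSpace n →L[ℝ] ℝ :=
  (ContinuousLinearMap.compL ℝ (HKSpace n) ℂ ℝ Complex.imCLM).comp B

/-- `dZ^i = dZ_{γ^i}`. -/
def dZ (i : Fin (n + 1)) : Form1 n :=
  (ContinuousLinearMap.proj (R := ℝ) (φ := fun _ : Fin (n + 1) => ℂ) i).comp
    (ContinuousLinearMap.fst ℝ _ _)

/-- `dζ^i`, as a real form. -/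
def dζ (i : Fin (n + 1)) : HKSpace n →L[ℝ] ℝ :=
  (ContinuousLinearMap.proj (R := ℝ) (φ := fun _ : Fin (n + 1) => ℝ) i).comp
    ((ContinuousLinearMap.fst ℝ _ _).comp (ContinuousLinearMap.snd ℝ _ _))

/-- `dζ̃_i`, as a real form. -/
def dζt (i : Fin (n + 1)) : HKSpace n →L[ℝ] ℝ :=
  (ContinuousLinearMap.proj (R := ℝ) (φ := fun _ : Fin (n + 1) => ℝ) i).comp
    ((ContinuousLinearMap.snd ℝ _ _).comp (ContinuousLinearMap.snd ℝ _ _))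

/-- `dζ_{γ^i} = -dζ^i`, as a complex valued form. -/
def dζLow (i : Fin (n + 1)) : Form1 n := -(Complex.ofRealCLM.comp (dζ i))

/-- `dζ_{γ̃_i} = dζ̃_i`, as a complex valued form. -/
def dζTilde (i : Fin (n + 1)) : Form1 n := Complex.ofRealCLM.comp (dζt i)

/-- `dZ_{γ̃_i} = -dZ_i = -τ_ij dZ^j`. -/
def dZTilde (F : (Fin (n + 1) → ℂ) → ℂ) (p : HKSpace n) (i : Fin (n + 1)) : Form1 n :=
  -∑ j, tauMat F p.1 i j • dZ j

/-- The central charge `Z_γ = q_i Z^i` of `γ = q_i γ^i`. -/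
def Zc (q : Fin (n + 1) → ℤ) (Z : Fin (n + 1) → ℂ) : ℂ := ∑ i, (q i : ℂ) * Z i

/-- `dZ_γ`. -/
def dZc (q : Fin (n + 1) → ℤ) : Form1 n := ∑ i, (q i : ℂ) • dZ i

/-- `ζ_γ = q_i ζ_{γ^i} = -q_i ζ^i`. -/
def ζc (q : Fin (n + 1) → ℤ) (p : HKSpace n) : ℝ := -∑ i, (q i : ℝ) * p.2.1 i

/-- `dζ_γ`. -/
def dζc (q : Fin (n + 1) → ℤ) : Form1 n := ∑ i, (q i : ℂ) • dζLow i

/-- `dZ_γ / Z_γ - d(conj Z_γ) / conj Z_γ`. -/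
def dArg (q : Fin (n + 1) → ℤ) (p : HKSpace n) : Form1 n :=
  (Zc q p.1)⁻¹ • dZc q - ((starRingEnd ℂ) (Zc q p.1))⁻¹ • conjForm (dZc q)

/-- `V_γ^inst = (1/2π) ∑_{m>0} e^{2πi m ζ_γ} K_0(2π m |Z_γ|)`. -/
def Vinst (q : Fin (n + 1) → ℤ) (p : HKSpace n) : ℂ :=
  (1 / (2 * Real.pi) : ℂ) * ∑' m : ℕ+,
    Complex.exp (2 * Real.pi * Complex.I * (m : ℕ) * ζc q p) *
      besselK 0 (2 * Real.pi * (m : ℕ) * ‖Zc q p.1‖)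

/-- `A_γ^inst = -(1/4π) ∑_{m>0} e^{2πi m ζ_γ} |Z_γ| K_1(2π m |Z_γ|) (dZ_γ/Z_γ - c.c.)`. -/
def Ainst (q : Fin (n + 1) → ℤ) (p : HKSpace n) : Form1 n :=
  (-(1 / (4 * Real.pi) : ℂ) * ∑' m : ℕ+,
    Complex.exp (2 * Real.pi * Complex.I * (m : ℕ) * ζc q p) * ‖Zc q p.1‖ *
      besselK 1 (2 * Real.pi * (m : ℕ) * ‖Zc q p.1‖)) • dArg q p

/-- `η_γ^inst = (i/8π²) ∑_{m>0} (e^{2πi m ζ_γ}/m) |Z_γ| K_1(2π m |Z_γ|) (dZ_γ/Z_γ - c.c.)`. -/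
def ηinst (q : Fin (n + 1) → ℤ) (p : HKSpace n) : Form1 n :=
  ((Complex.I / (8 * Real.pi ^ 2) : ℂ) * ∑' m : ℕ+,
    Complex.exp (2 * Real.pi * Complex.I * (m : ℕ) * ζc q p) / (m : ℕ) * ‖Zc q p.1‖ *
      besselK 1 (2 * Real.pi * (m : ℕ) * ‖Zc q p.1‖)) • dArg q p

variable (F : (Fin (n + 1) → ℂ) → ℂ) (Ω : (Fin (n + 1) → ℤ) → ℤ)

/-- The CASK metric `g_M = -Im(τ_ij) dZ^i d(conj Z^j)`, pulled back along `N → M`. -/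
def gM (p : HKSpace n) (X Y : HKSpace n) : ℝ :=
  -∑ i, ∑ j, imTau F p.1 i j * (X.1 i * (starRingEnd ℂ) (Y.1 j)).re

/-- The tensor `T = π^* g_M - ∑_γ Ω(γ) V_γ^inst |dZ_γ|²`. Since `Ω(γ) = Ω(-γ)`, the coefficients
become real after adding the terms of `γ` and `-γ`. -/
def tensorT (p X Y : HKSpace n) : ℝ :=
  gM F p X Y -
    reForm (∑' q : Fin (n + 1) → ℤ,
      ((Ω q : ℂ) * Vinst q p) • tensor (dZc q) (conjForm (dZc q))) X Y

/-- A mutually local variation of BPS structures on `U`, with the canonical central charge, whose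
support is contained in `span_ℤ {γ^i}`; mutual locality is automatic since the pairing vanishes
there. `Ω` is extended by `Ω(0) = 0`. -/
structure IsBPSVariation (U : Set (Fin (n + 1) → ℂ)) : Prop where
  zero : Ω 0 = 0
  even : ∀ q, Ω (-q) = Ω q
  /-- the support property -/
  support : ∀ K : Set (Fin (n + 1) → ℂ), IsCompact K → K ⊆ U →
    ∃ C : ℝ, 0 < C ∧ ∀ Z ∈ K, ∀ q, Ω q ≠ 0 → C * ‖(fun i => (q i : ℝ))‖ < ‖Zc q Z‖
  /-- normal convergence on compact sets of `∑_γ Ω(γ) e^{-R |Z_γ|}` -/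
  convergence : ∀ R : ℝ, 0 < R → ∀ K : Set (Fin (n + 1) → ℂ), IsCompact K → K ⊆ U →
    ∃ u : (Fin (n + 1) → ℤ) → ℝ, Summable u ∧
      ∀ Z ∈ K, ∀ q, |(Ω q : ℝ)| * Real.exp (-R * ‖Zc q Z‖) ≤ u q

/-- Compatibility over `U`: the tensor `T` is horizontally non-degenerate at all points of the
fibration over `U`. -/
def IsCompatible (U : Set (Fin (n + 1) → ℂ)) : Prop :=
  ∀ p : HKSpace n, p.1 ∈ U → ∀ X : HKSpace n, (∀ Y, tensorT F Ω p X Y = 0) → X.1 = 0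

/-- The maximal open subset of `M` on which `Ω` defines a variation of BPS structures that is
compatible with the CASK structure. -/
def maximalBase (M : Set (Fin (n + 1) → ℂ)) : Set (Fin (n + 1) → ℂ) :=
  ⋃₀ {U | IsOpen U ∧ U ⊆ M ∧ IsBPSVariation Ω U ∧ IsCompatible F Ω U}

/-- `⟨α ∧ β⟩ = α_{γ̃_i} ∧ β_{γ^i} - α_{γ^i} ∧ β_{γ̃_i}`. -/
def pairWedge (αt αl βt βl : Fin (n + 1) → Form1 n) : Form2 n :=
  ∑ i, (wedge (αt i) (βl i) - wedge (αl i) (βt i))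

/-- `ω_1 + i ω_2`. -/
def ωHol (p : HKSpace n) : Form2 n :=
  (-(2 * Real.pi) : ℂ) • (pairWedge (dZTilde F p) dZ dζTilde dζLow +
    ∑' q : Fin (n + 1) → ℤ, (Ω q : ℂ) •
      (wedge (dZc q) (Ainst q p) + (Complex.I * Vinst q p) • wedge (dζc q) (dZc q)))

/-- `ω_1`. -/
def ω₁ (p : HKSpace n) : HKSpace n →L[ℝ] HKSpace n →L[ℝ] ℝ := reForm (ωHol F Ω p)

/-- `ω_2`. -/
def ω₂ (p : HKSpace n) : HKSpace n →L[ℝ] HKSpace n →L[ℝ] ℝ := imForm (ωHol F Ω p)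

/-- `ω_3`; the complex expression below is real because `Ω(γ) = Ω(-γ)`. -/
def ω₃ (p : HKSpace n) : HKSpace n →L[ℝ] HKSpace n →L[ℝ] ℝ :=
  reForm ((2 * Real.pi : ℂ) •
    ((1 / 4 : ℂ) • pairWedge (dZTilde F p) dZ
        (fun i => conjForm (dZTilde F p i)) (fun i => conjForm (dZ i)) -
      (1 / 2 : ℂ) • pairWedge dζTilde dζLow dζTilde dζLow -
      ∑' q : Fin (n + 1) → ℤ, (Ω q : ℂ) •
        ((Complex.I / 2 * Vinst q p) • wedge (dZc q) (conjForm (dZc q)) +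
          wedge (dζc q) (Ainst q p))))

/-- The metric of a hyperkähler triple `ω_a(X, Y) = g(I_a X, Y)` with `I_1 I_2 = I_3` is determined
by the triple: as maps from the tangent to the cotangent space, `g = ω_3 ∘ ω_1⁻¹ ∘ ω_2`
(see `hkMetric_eq`). -/
def hkMetric (w₁ w₂ w₃ : HKSpace n →L[ℝ] HKSpace n →L[ℝ] ℝ) (X Y : HKSpace n) : ℝ :=
  w₃ (w₁.inverse (w₂ X)) Y

/-- `hkMetric` recovers the metric from the three Kähler forms. -/
theorem hkMetric_eq (g w₁ w₂ w₃ : HKSpace n →L[ℝ] HKSpace n →L[ℝ] ℝ)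
    (I₁ I₂ I₃ : HKSpace n →L[ℝ] HKSpace n)
    (hg : ∀ X, (∀ Y, g X Y = 0) → X = 0)
    (h₁ : ∀ X Y, w₁ X Y = g (I₁ X) Y) (h₂ : ∀ X Y, w₂ X Y = g (I₂ X) Y)
    (h₃ : ∀ X Y, w₃ X Y = g (I₃ X) Y)
    (sq₁ : ∀ X, I₁ (I₁ X) = -X) (sq₃ : ∀ X, I₃ (I₃ X) = -X) (h₁₂ : ∀ X, I₁ (I₂ X) = I₃ X)
    (X Y : HKSpace n) : hkMetric w₁ w₂ w₃ X Y = g X Y := by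
  have inj : Function.Injective w₁.toLinearMap := by
    rw [injective_iff_map_eq_zero]
    intro Z hZ
    have h0 : I₁ Z = 0 := hg _ fun Y => by
      rw [← h₁]
      exact congrArg (fun f : HKSpace n →L[ℝ] ℝ => f Y) hZ
    have h1 := sq₁ Z
    rw [h0, map_zero] at h1
    exact (neg_eq_zero.mp h1.symm)
  have fr : Module.finrank ℝ (HKSpace n) = Module.finrank ℝ (HKSpace n →L[ℝ] ℝ) := by
    rw [← (LinearMap.toContinuousLinearMap (𝕜 := ℝ) (E := HKSpace n) (F' := ℝ)).finrank_eq]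
    exact (Subspace.dual_finrank_eq (K := ℝ) (V := HKSpace n)).symm
  let e := (LinearEquiv.ofInjectiveOfFinrankEq w₁.toLinearMap inj fr).toContinuousLinearEquiv
  have he : w₁ = (e : HKSpace n →L[ℝ] HKSpace n →L[ℝ] ℝ) :=
    ContinuousLinearMap.ext fun _ => rfl
  have hw : w₁ (-(I₃ X)) = w₂ X := by
    refine ContinuousLinearMap.ext fun Z => ?_
    rw [h₁, h₂, map_neg, ← h₁₂, sq₁, neg_neg]
  have hi : w₁.inverse (w₂ X) = -(I₃ X) := by
    rw [← hw, he, ContinuousLinearMap.inverse_equiv]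
    exact e.symm_apply_apply _
  rw [hkMetric, hi, h₃, map_neg, sq₃, neg_neg]

/-- The instanton corrected hyperkähler metric `g_N`. -/
def gN (p X Y : HKSpace n) : ℝ := hkMetric (ω₁ F Ω p) (ω₂ F Ω p) (ω₃ F Ω p) X Y

/-- The rotating vector field `V = 2i Z^i ∂_{Z^i} - 2i conj(Z^i) ∂_{conj(Z^i)}`. -/
def rotField (p : HKSpace n) : HKSpace n := ((2 * Complex.I) • p.1, 0, 0)

/-- `r² = g_M(ξ, ξ) = -Im(τ_ij) Z^i conj(Z^j)`. -/
def rSq (Z : Fin (n + 1) → ℂ) : ℝ := -imTauNorm F Z Z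

/-- `d^c r² = i (∂̄ - ∂) r²`, i.e. `X ↦ -d(r²)(i X)`. -/
def dcRSq (p X : HKSpace n) : ℝ := -(fderiv ℝ (rSq F) p.1 (Complex.I • X.1))

/-- `∑_γ Ω(γ) η_γ^inst`; it takes real values because `Ω(γ) = Ω(-γ)`. -/
def ηSum (p : HKSpace n) : Form1 n := ∑' q : Fin (n + 1) → ℤ, (Ω q : ℂ) • ηinst q p

/-- The Hamiltonian `f = 2π (r² - 8 c_ℓ - ∑_γ Ω(γ) ι_V η_γ^inst)`. -/
def fHam (c : ℝ) (p : HKSpace n) : ℝ :=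
  2 * Real.pi * (rSq F p.1 - 8 * c - (ηSum Ω p (rotField p)).re)

/-- `f_3 = f - g_N(V, V) / 2`. -/
def fThree (c : ℝ) (p : HKSpace n) : ℝ :=
  fHam F Ω c p - 1 / 2 * gN F Ω p (rotField p) (rotField p)

/-- The subset `N'` of the points over `U` where `f`, `f_3` and `g_N(V, V)` do not vanish. -/
def NPrime (c : ℝ) (U : Set (Fin (n + 1) → ℂ)) : Set (HKSpace n) :=
  {p | p.1 ∈ U ∧ fHam F Ω c p ≠ 0 ∧ fThree F Ω c p ≠ 0 ∧
    gN F Ω p (rotField p) (rotField p) ≠ 0}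

/-- `Θ = π (dσ - ⟨ζ, dζ⟩)` with `⟨ζ, dζ⟩ = -ζ̃_i dζ^i + ζ^i dζ̃_i`. -/
def ΘForm (P X : PSpace n) : ℝ :=
  Real.pi * (X.2 - ∑ i, (-(P.1.2.2 i) * X.1.2.1 i + P.1.2.1 i * X.1.2.2 i))

/-- The connection form
`η = Θ + (πi/2) (∂̄ r² - ∂ r²) - 2π ∑_γ Ω(γ) η_γ^inst - (1/2) ι_V g_N`. -/
def connForm (P X : PSpace n) : ℝ :=
  ΘForm P X + Real.pi / 2 * dcRSq F P.1 X.1 - 2 * Real.pi * (ηSum Ω P.1 X.1).re -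
    1 / 2 * gN F Ω P.1 (rotField P.1) X.1

/-- `θ_0^P = -(1/2) df`. -/
def θ₀ (c : ℝ) (P X : PSpace n) : ℝ := -(1 / 2) * fderiv ℝ (fHam F Ω c) P.1 X.1

/-- `θ_1^P = (1/2) ι_V ω_2`. -/
def θ₁ (P X : PSpace n) : ℝ := 1 / 2 * ω₂ F Ω P.1 (rotField P.1) X.1

/-- `θ_2^P = -(1/2) ι_V ω_1`. -/
def θ₂ (P X : PSpace n) : ℝ := -(1 / 2) * ω₁ F Ω P.1 (rotField P.1) X.1

/-- `θ_3^P = η + (1/2) ι_V g_N`. -/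
def θ₃ (P X : PSpace n) : ℝ :=
  connForm F Ω P X + 1 / 2 * gN F Ω P.1 (rotField P.1) X.1

/-- The symmetric 2-tensor `-(1/f) ((2/f_3) η² + π_N^* g_N - (2/f) ∑_{i=0}^3 (θ_i^P)²)` before its
restriction to a hypersurface. -/
def preMetric (c : ℝ) (P X Y : PSpace n) : ℝ :=
  -(1 / fHam F Ω c P.1) *
    (2 / fThree F Ω c P.1 * (connForm F Ω P X * connForm F Ω P Y) + gN F Ω P.1 X.1 Y.1 -
      2 / fHam F Ω c P.1 * (θ₀ F Ω c P X * θ₀ F Ω c P Y + θ₁ F Ω P X * θ₁ F Ω P Y +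
        θ₂ F Ω P X * θ₂ F Ω P Y + θ₃ F Ω P X * θ₃ F Ω P Y))

/-! ### The quaternionic Kähler side -/

/-- `𝒦 = -log(-2 Im(τ_ij) z^i conj(z^j))` with `z^0 = 1`. -/
def kahlerPot (z : Fin n → ℂ) : ℝ :=
  -Real.log (-2 * imTauNorm F (Fin.cons 1 z) (Fin.cons 1 z))

/-- The parametrization of the hypersurface `{Arg Z^0 = 0}` by `(ρ, z^a, ζ^i, ζ̃_i, σ)`: one has
`Z^0 = 4 √(ρ + c_ℓ) e^{𝒦/2}`, which is equivalent to `16πρ = 2πr² - 16πc_ℓ`, and `Z^a = Z^0 z^a`. -/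
def embedding (c : ℝ) (p : QKSpace n) : PSpace n :=
  ((((4 * Real.sqrt (p.1 + c) * Real.exp (kahlerPot F p.2.1 / 2) : ℝ) : ℂ) •
      (Fin.cons 1 p.2.1 : Fin (n + 1) → ℂ), p.2.2.1, p.2.2.2.1), p.2.2.2.2)

/-- The metric `g_N̄` in the coordinates `(ρ, z^a, ζ^i, ζ̃_i, σ)`. -/
def qkMetric (c : ℝ) (p X Y : QKSpace n) : ℝ :=
  preMetric F Ω c (embedding F c p) (fderiv ℝ (embedding F c) p X)
    (fderiv ℝ (embedding F c) p Y)

/-- The lift `Ñ`, with non-periodic coordinates `(ζ^i, ζ̃_i, σ)`, of the hypersurface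
`{Arg Z^0 = 0}` in the part of `P` over `N'`, where `N` is the fibration over the maximal subset of
`M` on which the data are compatible. -/
def qkDomain (M : Set (Fin (n + 1) → ℂ)) (c : ℝ) : Set (QKSpace n) :=
  {p | 0 < p.1 + c ∧ (embedding F c p).1 ∈ NPrime F Ω c (maximalBase F Ω M)}

end HK

/-! ### Instanton corrected c-map spaces -/

/-- A CASK domain together with a mutually local variation of BPS structures on it whose support is
contained in `span_ℤ {γ^i}`. -/
structure CMapData (n : ℕ) where
  M : Set (Fin (n + 1) → ℂ)
  F : (Fin (n + 1) → ℂ) → ℂ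
  Ω : (Fin (n + 1) → ℤ) → ℤ
  cask : IsCASKDomain M F
  bps : IsBPSVariation Ω M

/-- The domain `Ñ` of the instanton corrected c-map space with 1-loop parameter `c`. -/
def CMapData.domain {n : ℕ} (D : CMapData n) (c : ℝ) : Set (QKSpace n) := qkDomain D.F D.Ω D.M c

/-- The metric of the instanton corrected c-map space with 1-loop parameter `c`. -/
def CMapData.metric {n : ℕ} (D : CMapData n) (c : ℝ) : QKSpace n → QKSpace n → QKSpace n → ℝ :=
  qkMetric D.F D.Ω c

/-! ### Instanton corrected q-map spaces -/

section QMap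

variable {n : ℕ}

/-- `k_abc x^a y^b w^c`. -/
def cubic (k : Fin n → Fin n → Fin n → ℝ) (x y w : Fin n → ℝ) : ℝ :=
  ∑ a, ∑ b, ∑ c, k a b c * x a * y b * w c

/-- `H` is a projective special real manifold for the cubic `h(t) = (1/6) k_abc t^a t^b t^c`: a
hypersurface contained in the regular level set `{h = 1}`, hence a relatively open subset of it, on
which `-∂²h_t(v, v) = -k_abc t^a v^b v^c` is positive definite on the tangent spaces
`{v | dh_t(v) = (1/2) k_abc t^a t^b v^c = 0}`. -/
structure IsPSR (k : Fin n → Fin n → Fin n → ℝ) (H : Set (Fin n → ℝ)) : Prop where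
  symm : ∀ a b c, k a b c = k b a c ∧ k a b c = k a c b
  relOpen : ∃ O : Set (Fin n → ℝ), IsOpen O ∧ H = O ∩ {t | 1 / 6 * cubic k t t t = 1}
  posDef : ∀ t ∈ H, ∀ v : Fin n → ℝ, v ≠ 0 → cubic k t t v = 0 → 0 < -cubic k t v v

/-- `t^a = Im(Z^a / Z^0)`. -/
def tCoord (Z : Fin (n + 1) → ℂ) (a : Fin n) : ℝ := (Z a.succ / Z 0).im

/-- `M^cl`: the points with `Z^0 ≠ 0` and `t ∈ ℝ_{>0} · H`. -/
def Mcl (H : Set (Fin n → ℝ)) : Set (Fin (n + 1) → ℂ) :=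
  {Z | Z 0 ≠ 0 ∧ ∃ l : ℝ, 0 < l ∧ ∃ t ∈ H, tCoord Z = l • t}

/-- `q_a t^a` for `γ̂ = q_a γ^a`. -/
def qt (q : Fin n → ℕ) (Z : Fin (n + 1) → ℂ) : ℝ := ∑ a, (q a : ℝ) * tCoord Z a

/-- `M^q`. The semigroup `Λ⁺` consists of the non-zero vectors `q : Fin n → ℕ`. -/
def Mq (H : Set (Fin n → ℝ)) (N : (Fin n → ℕ) → ℤ) : Set (Fin (n + 1) → ℂ) :=
  Mcl H ∩ {Z | ∀ q : Fin n → ℕ, q ≠ 0 → N q ≠ 0 → 0 < qt q Z}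

/-- The polylogarithm `Li_3(x) = ∑_{m>0} x^m / m^3`, for `|x| ≤ 1`. -/
def polylog3 (x : ℂ) : ℂ := ∑' m : ℕ+, x ^ (m : ℕ) / ((m : ℕ) : ℂ) ^ 3

/-- The prepotential
`-(1/6) k_abc Z^a Z^b Z^c / Z^0 + χ (Z^0)² ζ(3) / (2 (2πi)³)
  - (Z^0)²/(2πi)³ ∑_{q ∈ Λ⁺} n_q Li_3(e^{2πi q_a Z^a / Z^0})`. -/
def qPrepotential (k : Fin n → Fin n → Fin n → ℝ) (χ : ℤ) (N : (Fin n → ℕ) → ℤ)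
    (Z : Fin (n + 1) → ℂ) : ℂ :=
  -(1 / 6) * (∑ a : Fin n, ∑ b : Fin n, ∑ c : Fin n,
      (k a b c : ℂ) * Z a.succ * Z b.succ * Z c.succ) / Z 0 +
    χ * (Z 0 ^ 2 * riemannZeta 3) / (2 * (2 * Real.pi * Complex.I) ^ 3) -
    Z 0 ^ 2 / (2 * Real.pi * Complex.I) ^ 3 *
      ∑' q : {q : Fin n → ℕ // q ≠ 0}, (N q : ℂ) *
        polylog3 (Complex.exp (2 * Real.pi * Complex.I * ∑ a : Fin n, (q.1 a : ℂ) * (Z a.succ / Z 0)))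

open Classical in
/-- The BPS indices `Ω(q_0 γ^0) = -χ` for `q_0 ≠ 0`, `Ω(q_0 γ^0 ± q_a γ^a) = n_{q_a γ^a}` for
`q_a γ^a ∈ Λ⁺`, and `Ω = 0` otherwise. -/
def qBPS (χ : ℤ) (N : (Fin n → ℕ) → ℤ) (q : Fin (n + 1) → ℤ) : ℤ :=
  if ∀ a : Fin n, q a.succ = 0 then (if q 0 = 0 then 0 else -χ)
  else if ∀ a : Fin n, 0 ≤ q a.succ then N (fun a => (q a.succ).toNat)
  else if ∀ a : Fin n, q a.succ ≤ 0 then N (fun a => (-(q a.succ)).toNat)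
  else 0

end QMap

/-- The initial data of an instanton corrected q-map space: a projective special real manifold `H`
with cubic form `k`, an integer `χ`, and integers `n_q` for `q ∈ Λ⁺` (the value at `0` is not used)
such that `M^q` is open and `∑_q |n_q| e^{-ε q_a t^a}` converges normally on compact subsets of
`M^q` for all `ε > 0`. -/
structure QMapData (n : ℕ) where
  k : Fin n → Fin n → Fin n → ℝ
  H : Set (Fin n → ℝ)
  χ : ℤ
  N : (Fin n → ℕ) → ℤ
  psr : IsPSR k H
  isOpen_Mq : IsOpen (Mq H N)
  growth : ∀ ε : ℝ, 0 < ε → ∀ K : Set (Fin (n + 1) → ℂ), IsCompact K → K ⊆ Mq H N →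
    ∃ u : {q : Fin n → ℕ // q ≠ 0} → ℝ, Summable u ∧
      ∀ Z ∈ K, ∀ q : {q : Fin n → ℕ // q ≠ 0}, |(N q : ℝ)| * Real.exp (-ε * qt q.1 Z) ≤ u q

namespace QMapData

variable {n : ℕ} (Q : QMapData n)

/-- The prepotential. -/
def F : (Fin (n + 1) → ℂ) → ℂ := qPrepotential Q.k Q.χ Q.N

/-- The BPS indices. -/
def Ω : (Fin (n + 1) → ℤ) → ℤ := qBPS Q.χ Q.N

/-- The maximal open subset of `M^q` on which the pointwise conditions of a CASK domain hold. -/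
def M : Set (Fin (n + 1) → ℂ) :=
  ⋃₀ {U | IsOpen U ∧ U ⊆ Mq Q.H Q.N ∧ ∀ Z ∈ U, CASKCondition Q.F Z}

/-- The domain `Ñ` of the instanton corrected q-map space with 1-loop parameter `c`. -/
def domain (c : ℝ) : Set (QKSpace n) := qkDomain Q.F Q.Ω Q.M c

/-- The metric of the instanton corrected q-map space with 1-loop parameter `c`. -/
def metric (c : ℝ) : QKSpace n → QKSpace n → QKSpace n → ℝ := qkMetric Q.F Q.Ω c

end QMapData

end

noncomputable section

/-! The metric sees the point (ζ, ζ̃, σ) in only two ways: through the phases e^{2πi m ζ_γ} in the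
instanton sums, and through the coefficients of Θ = π(dσ + ζ̃_i dζ^i - ζ^i dζ̃_i). Under a
Heisenberg element ζ_γ changes by -q_i η^i, so a phase is unchanged as soon as q_i η^i is an
integer, and this matters only for charges with Ω(γ) ≠ 0. That condition is `Heis.IsIntegralOn`. The
form Θ is invariant under the whole real group, because the σ-component of the action is chosen to
compensate the translation of its coefficients (`ΘForm_actP`).

The action therefore lifts to the circle bundle side (`Heis.actP`) and preserves every ingredient of
`preMetric`. The parametrization `embedding` intertwines the two actions, since it rescales only by
a function of ρ and z (`embedding_smul`, `fderiv_embedding_smul`). This yields the criterion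
`actsByIsometries_of_isIntegralOn`.

It remains to find integral subgroups. If all η^i are integers, so is every q_i η^i. If all n_γ̂
vanish, the support of Ω lies on the line ℤγ^0, and only q_0 η^0 has to be an integer.

Sums are compared term by term and derivatives by equivariance, so neither convergence nor
smoothness enters. -/

section HeisenbergSymmetry

variable {n : ℕ}

/-! ### The affine Heisenberg action and its lift to the circle bundle side. -/

namespace Heis

/-- The translation vector of `h` on the coordinate space of `(Z^i, ζ^i, ζ̃_i)`. -/
def shift (h : Heis n) : HKSpace n := (0, h.η, h.ηt)

/-- The linear form `⟨ζ, h⟩ = ζ̃_i η^i - ζ^i η̃_i`. -/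
def pairing (h : Heis n) : (Fin (n + 1) → ℝ) × (Fin (n + 1) → ℝ) →L[ℝ] ℝ :=
  LinearMap.toContinuousLinearMap
    { toFun := fun x => ∑ i, (x.2 i * h.η i - x.1 i * h.ηt i)
      map_add' := fun x y => by
        rw [← Finset.sum_add_distrib]
        exact Finset.sum_congr rfl fun i _ => by simp only [Prod.fst_add, Prod.snd_add, Pi.add_apply]; ring
      map_smul' := fun r x => by
        simp only [Prod.smul_fst, Prod.smul_snd, Pi.smul_apply, smul_eq_mul, RingHom.id_apply,
          Finset.mul_sum]
        exact Finset.sum_congr rfl fun i _ => by ring }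

theorem pairing_apply (h : Heis n) (x : (Fin (n + 1) → ℝ) × (Fin (n + 1) → ℝ)) :
    h.pairing x = ∑ i, (x.2 i * h.η i - x.1 i * h.ηt i) := rfl

/-- The linear part of the affine map `p ↦ h • p` on the coordinate space. -/
def linearPart (h : Heis n) : QKSpace n →L[ℝ] QKSpace n :=
  ContinuousLinearMap.id ℝ (QKSpace n) +
    (ContinuousLinearMap.inr ℝ _ _ ∘L ContinuousLinearMap.inr ℝ _ _ ∘L
      ContinuousLinearMap.inr ℝ _ _ ∘L ContinuousLinearMap.inr ℝ _ _ ∘L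
      h.pairing ∘L
        ((ContinuousLinearMap.fst ℝ _ _ ∘L ContinuousLinearMap.snd ℝ _ _ ∘L
            ContinuousLinearMap.snd ℝ _ _).prod
          (ContinuousLinearMap.fst ℝ _ _ ∘L ContinuousLinearMap.snd ℝ _ _ ∘L
            ContinuousLinearMap.snd ℝ _ _ ∘L ContinuousLinearMap.snd ℝ _ _)))

theorem linearPart_apply (h : Heis n) (X : QKSpace n) :
    h.linearPart X = (X.1, X.2.1, X.2.2.1, X.2.2.2.1,
      X.2.2.2.2 + h.pairing (X.2.2.1, X.2.2.2.1)) := by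
  simp [linearPart, Prod.ext_iff]

theorem smul_def (h : Heis n) (p : QKSpace n) :
    h • p = (p.1, p.2.1, p.2.2.1 + h.η, p.2.2.2.1 + h.ηt,
      p.2.2.2.2 + h.κ + h.pairing (p.2.2.1, p.2.2.2.1)) := rfl

theorem smul_eq_linearPart_add (h : Heis n) (p : QKSpace n) :
    h • p = h.linearPart p + (0, 0, h.η, h.ηt, h.κ) := by
  rw [smul_def, linearPart_apply]
  simp [Prod.ext_iff]
  ring

theorem hasFDerivAt_smul (h : Heis n) (p : QKSpace n) :
    HasFDerivAt (fun x : QKSpace n => h • x) h.linearPart p := by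
  simp only [smul_eq_linearPart_add]
  exact h.linearPart.hasFDerivAt.add_const _

theorem contDiff_smul (h : Heis n) : ContDiff ℝ ∞ (fun x : QKSpace n => h • x) := by
  simp only [smul_eq_linearPart_add]
  exact h.linearPart.contDiff.add contDiff_const

/-- The linear part of the lifted action on the circle bundle side. -/
def linearPartP (h : Heis n) : PSpace n →L[ℝ] PSpace n :=
  ContinuousLinearMap.id ℝ (PSpace n) +
    ContinuousLinearMap.inr ℝ _ _ ∘L h.pairing ∘L
      ContinuousLinearMap.snd ℝ _ _ ∘L ContinuousLinearMap.fst ℝ _ _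

theorem linearPartP_apply (h : Heis n) (X : PSpace n) :
    h.linearPartP X = (X.1, X.2 + h.pairing X.1.2) := by
  simp [linearPartP, Prod.ext_iff]

/-- The lifted action on the circle bundle side. -/
def actP (h : Heis n) (P : PSpace n) : PSpace n :=
  (P.1 + h.shift, P.2 + h.κ + h.pairing P.1.2)

theorem actP_eq (h : Heis n) (P : PSpace n) :
    h.actP P = h.linearPartP P + (h.shift, h.κ) := by
  rw [linearPartP_apply, actP]
  simp [Prod.ext_iff]
  ring

theorem hasFDerivAt_actP (h : Heis n) (P : PSpace n) :
    HasFDerivAt h.actP h.linearPartP P := by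
  have : h.actP = fun P => h.linearPartP P + (h.shift, h.κ) := funext h.actP_eq
  rw [this]
  exact h.linearPartP.hasFDerivAt.add_const _

/-- `h` shifts `ζ_γ` by an integer for every charge `γ` in the support of `Ω`. -/
def IsIntegralOn (h : Heis n) (Ω : (Fin (n + 1) → ℤ) → ℤ) : Prop :=
  ∀ q, Ω q ≠ 0 → ∃ m : ℤ, ∑ i, (q i : ℝ) * h.η i = m

end Heis

/-! ### Invariance of the hyperkähler data under integral shifts. -/

variable {F : (Fin (n + 1) → ℂ) → ℂ} {Ω : (Fin (n + 1) → ℤ) → ℤ} {h : Heis n}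

theorem add_shift_fst (h : Heis n) (p : HKSpace n) : (p + h.shift).1 = p.1 := by
  simp [Heis.shift]

theorem ζc_add_shift (h : Heis n) (q : Fin (n + 1) → ℤ) (p : HKSpace n) :
    ζc q (p + h.shift) = ζc q p - ∑ i, (q i : ℝ) * h.η i := by
  simp only [ζc, Heis.shift, Prod.snd_add, Prod.fst_add, Pi.add_apply, mul_add,
    Finset.sum_add_distrib]
  ring

/-- Periodicity of the exponential. All uses of integrality in the invariance of the hyperkähler
data reduce to this one. -/
theorem exp_ζc_add_shift {q : Fin (n + 1) → ℤ} {l : ℤ} (hl : ∑ i, (q i : ℝ) * h.η i = l)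
    (p : HKSpace n) (m : ℕ+) :
    Complex.exp (2 * Real.pi * Complex.I * (m : ℕ) * ζc q (p + h.shift)) =
      Complex.exp (2 * Real.pi * Complex.I * (m : ℕ) * ζc q p) := by
  rw [ζc_add_shift, hl, Complex.exp_eq_exp_iff_exists_int]
  -- Since ζ_γ drops by l, the exponent of the m-th term drops by m l periods 2πi.
  refine ⟨-((m : ℕ) * l), ?_⟩
  push_cast
  ring

theorem dArg_add_shift (h : Heis n) (q : Fin (n + 1) → ℤ) (p : HKSpace n) :
    dArg q (p + h.shift) = dArg q p := by
  simp only [dArg, add_shift_fst]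

theorem Vinst_add_shift {q : Fin (n + 1) → ℤ} {l : ℤ} (hl : ∑ i, (q i : ℝ) * h.η i = l)
    (p : HKSpace n) : Vinst q (p + h.shift) = Vinst q p := by
  simp only [Vinst, exp_ζc_add_shift hl, add_shift_fst]

theorem Ainst_add_shift {q : Fin (n + 1) → ℤ} {l : ℤ} (hl : ∑ i, (q i : ℝ) * h.η i = l)
    (p : HKSpace n) : Ainst q (p + h.shift) = Ainst q p := by
  simp only [Ainst, exp_ζc_add_shift hl, add_shift_fst, dArg_add_shift]

theorem ηinst_add_shift {q : Fin (n + 1) → ℤ} {l : ℤ} (hl : ∑ i, (q i : ℝ) * h.η i = l)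
    (p : HKSpace n) : ηinst q (p + h.shift) = ηinst q p := by
  simp only [ηinst, exp_ζc_add_shift hl, add_shift_fst, dArg_add_shift]

/-- Removes the charges with Ω(γ) = 0 from consideration: their instanton terms may really change
under the shift, but they enter with coefficient zero. -/
theorem intCast_smul_congr {E : Type*} [AddCommGroup E] [Module ℂ E] {l : ℤ} {x y : E}
    (hxy : l ≠ 0 → x = y) : (l : ℂ) • x = (l : ℂ) • y := by
  by_cases hl : l = 0
  · simp [hl]
  · rw [hxy hl]

theorem dZTilde_add_shift (h : Heis n) (p : HKSpace n) :
    dZTilde F (p + h.shift) = dZTilde F p := by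
  funext i
  rw [dZTilde, dZTilde, add_shift_fst]

/-- The semi-flat part depends on Z alone, and the instanton series agree summand by summand, so no
summability is needed. -/
theorem ωHol_add_shift (hΩ : h.IsIntegralOn Ω) (p : HKSpace n) :
    ωHol F Ω (p + h.shift) = ωHol F Ω p := by
  unfold ωHol
  congr 2
  · rw [dZTilde_add_shift]
  · refine tsum_congr fun q => ?_
    refine intCast_smul_congr (E := Form2 n) fun hq => ?_
    obtain ⟨l, hl⟩ := hΩ q hq
    rw [Vinst_add_shift hl, Ainst_add_shift hl]

theorem ω₃_add_shift (hΩ : h.IsIntegralOn Ω) (p : HKSpace n) :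
    ω₃ F Ω (p + h.shift) = ω₃ F Ω p := by
  unfold ω₃
  congr 3
  · rw [dZTilde_add_shift]
  · refine tsum_congr fun q => ?_
    refine intCast_smul_congr (E := Form2 n) fun hq => ?_
    obtain ⟨l, hl⟩ := hΩ q hq
    rw [Vinst_add_shift hl, Ainst_add_shift hl]

theorem ηSum_add_shift (hΩ : h.IsIntegralOn Ω) (p : HKSpace n) :
    ηSum Ω (p + h.shift) = ηSum Ω p := by
  refine tsum_congr fun q => ?_
  refine intCast_smul_congr (E := Form1 n) fun hq => ?_
  obtain ⟨l, hl⟩ := hΩ q hq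
  rw [ηinst_add_shift hl]

theorem ω₁_add_shift (hΩ : h.IsIntegralOn Ω) (p : HKSpace n) :
    ω₁ F Ω (p + h.shift) = ω₁ F Ω p := by
  rw [ω₁, ω₁, ωHol_add_shift hΩ]

theorem ω₂_add_shift (hΩ : h.IsIntegralOn Ω) (p : HKSpace n) :
    ω₂ F Ω (p + h.shift) = ω₂ F Ω p := by
  rw [ω₂, ω₂, ωHol_add_shift hΩ]

/-- The metric is a function of the three forms alone, so their invariance suffices, without
invertibility of ω_1. -/
theorem gN_add_shift (hΩ : h.IsIntegralOn Ω) (p : HKSpace n) :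
    gN F Ω (p + h.shift) = gN F Ω p := by
  funext X Y
  rw [gN, gN, ω₁_add_shift hΩ, ω₂_add_shift hΩ, ω₃_add_shift hΩ]

theorem rotField_add_shift (h : Heis n) (p : HKSpace n) :
    rotField (p + h.shift) = rotField p := by
  rw [rotField, rotField, add_shift_fst]

theorem fHam_add_shift (hΩ : h.IsIntegralOn Ω) (c : ℝ) (p : HKSpace n) :
    fHam F Ω c (p + h.shift) = fHam F Ω c p := by
  rw [fHam, fHam, add_shift_fst, ηSum_add_shift hΩ, rotField_add_shift]

theorem fderiv_fHam_add_shift (hΩ : h.IsIntegralOn Ω) (c : ℝ) (p : HKSpace n) :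
    fderiv ℝ (fHam F Ω c) (p + h.shift) = fderiv ℝ (fHam F Ω c) p := by
  rw [← fderiv_comp_add_right]
  exact congrArg (fun f => fderiv ℝ f p) (funext fun x => fHam_add_shift hΩ c x)

theorem fThree_add_shift (hΩ : h.IsIntegralOn Ω) (c : ℝ) (p : HKSpace n) :
    fThree F Ω c (p + h.shift) = fThree F Ω c p := by
  rw [fThree, fThree, fHam_add_shift hΩ, gN_add_shift hΩ, rotField_add_shift]

/-! ### Invariance of the connection form and of the tensor before restriction. -/

theorem dcRSq_add_shift (h : Heis n) (p X : HKSpace n) :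
    dcRSq F (p + h.shift) X = dcRSq F p X := by
  rw [dcRSq, dcRSq, add_shift_fst]

/-- Translating the base point adds η̃_i dζ^i - η^i dζ̃_i to Θ/π, while the differential of the
action adds η^i dζ̃_i - η̃_i dζ^i to dσ. The two cancel for every real h. -/
theorem ΘForm_actP (h : Heis n) (P X : PSpace n) :
    ΘForm (h.actP P) (h.linearPartP X) = ΘForm P X := by
  rw [ΘForm, ΘForm, Heis.linearPartP_apply, Heis.pairing_apply]
  congr 1
  rw [add_sub_assoc, ← Finset.sum_sub_distrib, sub_eq_add_neg, ← Finset.sum_neg_distrib]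
  congr 1
  refine Finset.sum_congr rfl fun i _ => ?_
  simp only [Heis.actP, Heis.shift, Prod.fst_add, Prod.snd_add, Pi.add_apply]
  ring

theorem connForm_actP (hΩ : h.IsIntegralOn Ω) (P X : PSpace n) :
    connForm F Ω (h.actP P) (h.linearPartP X) = connForm F Ω P X := by
  rw [connForm, connForm, ΘForm_actP, Heis.linearPartP_apply]
  simp only [Heis.actP, dcRSq_add_shift, ηSum_add_shift hΩ, gN_add_shift hΩ, rotField_add_shift]

/-- The tensor defining the quaternionic Kähler metric is invariant under the lifted action. -/
theorem preMetric_actP (hΩ : h.IsIntegralOn Ω) (c : ℝ) (P X Y : PSpace n) :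
    preMetric F Ω c (h.actP P) (h.linearPartP X) (h.linearPartP Y) = preMetric F Ω c P X Y := by
  simp only [preMetric, θ₀, θ₁, θ₂, θ₃, connForm_actP hΩ]
  simp only [Heis.linearPartP_apply, Heis.actP, fHam_add_shift hΩ, fThree_add_shift hΩ,
    gN_add_shift hΩ, fderiv_fHam_add_shift hΩ, ω₁_add_shift hΩ, ω₂_add_shift hΩ,
    rotField_add_shift]

/-! ### Equivariance of the parametrization of the hypersurface. -/

theorem embedding_smul (h : Heis n) (c : ℝ) (p : QKSpace n) :
    embedding F c (h • p) = h.actP (embedding F c p) := by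
  simp [embedding, Heis.smul_def, Heis.actP, Heis.shift]

/-- Equivariance writes the parametrization as its own conjugate by h, and the chain rule carries a
derivative at p to one at h • p. -/
theorem hasFDerivAt_embedding_smul {c : ℝ} {p : QKSpace n} {E : QKSpace n →L[ℝ] PSpace n}
    (h : Heis n) (hE : HasFDerivAt (embedding F c) E p) :
    HasFDerivAt (embedding F c) (h.linearPartP ∘L E ∘L h⁻¹.linearPart) (h • p) := by
  have e : embedding F c = h.actP ∘ embedding F c ∘ fun x => h⁻¹ • x := by
    funext x
    simp only [Function.comp_apply, ← embedding_smul, smul_inv_smul]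
  have hp : h⁻¹ • h • p = p := inv_smul_smul h p
  rw [e]
  refine (h.hasFDerivAt_actP _).comp _ (HasFDerivAt.comp _ ?_ (h⁻¹.hasFDerivAt_smul _))
  rwa [hp]

theorem linearPart_inv_apply (h : Heis n) (X : QKSpace n) :
    h⁻¹.linearPart (h.linearPart X) = X := by
  -- Differentiate h⁻¹ • (h • x) = x. The maps are affine, so the base point is immaterial and X
  -- itself serves.
  have e := (h⁻¹.hasFDerivAt_smul (h • X)).comp X (h.hasFDerivAt_smul X)
  have e' : ((fun x : QKSpace n => h⁻¹ • x) ∘ fun x => h • x) = id :=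
    funext fun x => inv_smul_smul h x
  rw [e'] at e
  exact DFunLike.congr_fun (e.unique (hasFDerivAt_id X)) X

/-- The differential of the parametrization is equivariant; no differentiability is needed. -/
theorem fderiv_embedding_smul (h : Heis n) (c : ℝ) (p X : QKSpace n) :
    fderiv ℝ (embedding F c) (h • p) (h.linearPart X) =
      h.linearPartP (fderiv ℝ (embedding F c) p X) := by
  by_cases hd : DifferentiableAt ℝ (embedding F c) p
  · rw [(hasFDerivAt_embedding_smul h hd.hasFDerivAt).fderiv]
    simp only [ContinuousLinearMap.comp_apply, linearPart_inv_apply]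
  -- Applying the transport of derivatives to h⁻¹ shows that differentiability fails at h • p too,
  -- so both `fderiv` take the default value 0.
  · have hd' : ¬DifferentiableAt ℝ (embedding F c) (h • p) := fun hd' => hd <| by
      have := (hasFDerivAt_embedding_smul h⁻¹ hd'.hasFDerivAt).differentiableAt
      rwa [inv_smul_smul] at this
    rw [fderiv_zero_of_not_differentiableAt hd, fderiv_zero_of_not_differentiableAt hd']
    simp

/-! ### The isometry criterion. -/

theorem qkMetric_smul (hΩ : h.IsIntegralOn Ω) (c : ℝ) (p X Y : QKSpace n) :
    qkMetric F Ω c (h • p) (h.linearPart X) (h.linearPart Y) = qkMetric F Ω c p X Y := by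
  rw [qkMetric, qkMetric, fderiv_embedding_smul, fderiv_embedding_smul, embedding_smul,
    preMetric_actP hΩ]

/-- The action fixes ρ and z, hence Z, so the conditions ρ > -c and Z in the maximal base persist;
the other conditions are the non-vanishing of invariant functions. -/
theorem smul_mem_qkDomain (hΩ : h.IsIntegralOn Ω) {M : Set (Fin (n + 1) → ℂ)} {c : ℝ}
    {p : QKSpace n} (hp : p ∈ qkDomain F Ω M c) : h • p ∈ qkDomain F Ω M c := by
  obtain ⟨hc, hM, h₁, h₂, h₃⟩ := hp
  refine ⟨hc, ?_⟩
  rw [embedding_smul]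
  refine ⟨?_, ?_, ?_, ?_⟩
  · simpa only [Heis.actP, add_shift_fst] using hM
  · simpa only [Heis.actP, fHam_add_shift hΩ] using h₁
  · simpa only [Heis.actP, fThree_add_shift hΩ] using h₂
  · simpa only [Heis.actP, gN_add_shift hΩ, rotField_add_shift] using h₃

/-- For a subgroup, stability gives equality: p is the image of g⁻¹ • p, which again lies in the
set. -/
theorem image_smul_eq_of_forall_mem {G α : Type*} [Group G] [MulAction G α] {H : Subgroup G}
    {N : Set α} (hN : ∀ g ∈ H, ∀ p ∈ N, g • p ∈ N) {g : G} (hg : g ∈ H) :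
    (fun p : α => g • p) '' N = N := by
  refine Set.Subset.antisymm ?_ fun p hp => ⟨g⁻¹ • p, hN _ (H.inv_mem hg) p hp, smul_inv_smul g p⟩
  rintro _ ⟨p, hp, rfl⟩
  exact hN g hg p hp

/-- A subgroup of the Heisenberg group which shifts the `ζ_γ` in the support of `Ω` by integers
acts by isometries, also on the part `{ρ > 0}`. -/
theorem actsByIsometries_of_isIntegralOn {H : Subgroup (Heis n)}
    (hH : ∀ h ∈ H, h.IsIntegralOn Ω) (M : Set (Fin (n + 1) → ℂ)) (c : ℝ) :
    ActsByIsometries H (qkDomain F Ω M c) (qkMetric F Ω c) ∧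
      ActsByIsometries H (qkDomain F Ω M c ∩ {p | 0 < p.1}) (qkMetric F Ω c) := by
  refine ⟨fun h hh => ⟨?_, h.contDiff_smul, fun p _ X Y => ?_⟩,
    fun h hh => ⟨?_, h.contDiff_smul, fun p _ X Y => ?_⟩⟩
  · exact image_smul_eq_of_forall_mem (fun g hg p hp => smul_mem_qkDomain (hH g hg) hp) hh
  · rw [(h.hasFDerivAt_smul p).fderiv, qkMetric_smul (hH h hh)]
  · refine image_smul_eq_of_forall_mem (fun g hg p hp => ?_) hh
    exact ⟨smul_mem_qkDomain (hH g hg) hp.1, hp.2⟩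
  · rw [(h.hasFDerivAt_smul p).fderiv, qkMetric_smul (hH h hh)]

/-! ### Subgroups with integral shifts. -/

theorem isIntegralOn_of_mem_discrete (hh : h ∈ Heis.discrete n) : h.IsIntegralOn Ω := by
  intro q _
  choose m hm using hh
  refine ⟨∑ i, q i * m i, ?_⟩
  push_cast
  exact Finset.sum_congr rfl fun i _ => by rw [hm]

/-- Without the n_γ̂, only the charges q_0 γ^0 can carry a BPS index. -/
theorem qBPS_eq_zero {χ : ℤ} {N : (Fin n → ℕ) → ℤ} (hN : ∀ q : Fin n → ℕ, q ≠ 0 → N q = 0)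
    {q : Fin (n + 1) → ℤ} {a : Fin n} (ha : q a.succ ≠ 0) : qBPS χ N q = 0 := by
  rw [qBPS, if_neg fun h0 => ha (h0 a)]
  split_ifs with h₁ h₂
  -- The value N 0 is arbitrary, so the truncated vector must be seen to be non-zero: in this case
  -- its a-th entry is q_a > 0, and in the next case it is -q_a > 0.
  · refine hN _ fun h0 => ?_
    have := congrFun h0 a
    have := h₁ a
    simp only [Pi.zero_apply] at *
    omega
  · refine hN _ fun h0 => ?_
    have := congrFun h0 a
    have := h₂ a
    simp only [Pi.zero_apply] at *
    omega
  · rfl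

/-- On the support of Ω the sum q_i η^i collapses to q_0 η^0, so the remaining η^a are free real
parameters. -/
theorem isIntegralOn_qBPS_of_mem_integralZero {χ : ℤ} {N : (Fin n → ℕ) → ℤ}
    (hN : ∀ q : Fin n → ℕ, q ≠ 0 → N q = 0) (hh : h ∈ Heis.integralZero n) :
    h.IsIntegralOn (qBPS χ N) := by
  intro q hq
  obtain ⟨m, hm⟩ := hh
  have h0 : ∀ a : Fin n, q a.succ = 0 := fun a => by
    by_contra ha
    exact hq (qBPS_eq_zero hN ha)
  refine ⟨q 0 * m, ?_⟩
  simp [Fin.sum_univ_succ, h0, hm]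

theorem codimOne_le_integralZero (n : ℕ) : Heis.codimOne n ≤ Heis.integralZero n :=
  by
  intro h (hh : h.η 0 = 0)
  show ∃ m : ℤ, h.η 0 = m
  exact ⟨0, by simp [hh]⟩

end HeisenbergSymmetry

/-- The Heisenberg isometries of instanton corrected c-map and q-map spaces. The domain is the maximal
one, contained in `{ρ > -c_ℓ}`; the same is asserted for its part with `ρ > 0`. -/
theorem proposition4p4 (n : ℕ) (c : ℝ) :
    (∀ D : CMapData n,
      ActsByIsometries (Heis.discrete n) (D.domain c) (D.metric c) ∧
      ActsByIsometries (Heis.discrete n) (D.domain c ∩ {p | 0 < p.1}) (D.metric c)) ∧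
    (∀ Q : QMapData n,
      (ActsByIsometries (Heis.discrete n) (Q.domain c) (Q.metric c) ∧
        ActsByIsometries (Heis.discrete n) (Q.domain c ∩ {p | 0 < p.1}) (Q.metric c)) ∧
      ((∀ q : Fin n → ℕ, q ≠ 0 → Q.N q = 0) →
        (ActsByIsometries (Heis.integralZero n) (Q.domain c) (Q.metric c) ∧
          ActsByIsometries (Heis.integralZero n) (Q.domain c ∩ {p | 0 < p.1}) (Q.metric c)) ∧
        (ActsByIsometries (Heis.codimOne n) (Q.domain c) (Q.metric c) ∧
          ActsByIsometries (Heis.codimOne n) (Q.domain c ∩ {p | 0 < p.1}) (Q.metric c)))) := by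
  -- Both kinds of spaces are given by the same `qkDomain` and `qkMetric`, and the criterion holds
  -- for any F, Ω and M. The q-map case thus follows directly, without first checking that its data
  -- form a CASK domain with a BPS variation.
  refine ⟨fun D => actsByIsometries_of_isIntegralOn (fun _ => isIntegralOn_of_mem_discrete) D.M c,
    fun Q => ⟨actsByIsometries_of_isIntegralOn (fun _ => isIntegralOn_of_mem_discrete) Q.M c,
      fun hN => ⟨?_, ?_⟩⟩⟩
  · exact actsByIsometries_of_isIntegralOn
      (fun _ => isIntegralOn_qBPS_of_mem_integralZero hN) Q.M c
  · exact actsByIsometries_of_isIntegralOn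
      (fun _ hh => isIntegralOn_qBPS_of_mem_integralZero hN (codimOne_le_integralZero n hh)) Q.M c

end
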